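/- Let $n\ge 2$ and let $p:\mathbb{R}^n\to[1,\infty)$ be a bounded measurable variable exponent such that $1/p$ is log-Hölder continuous, i.e. $\left|\frac1{p(x)}-\frac1{p(y)}\right|\le \frac{L}{\log(e+1/|x-y|)}$ for some $L>0$ and all $x\neq y$ in $\mathbb{R}^n$, and such that $1<p^-<n$, where $p^-:=\operatorname{ess\,inf}_{\mathbb{R}^n}p$. Let $\mathcal{A}:\mathbb{R}^n\times\mathbb{R}\times\mathbb{R}^n\to\mathbb{R}^n$ be a Carathéodory function ($\mathcal A(x,t,\xi)$ is measurable in $x$ and continuous in $(t,\xi)$) of $p(\cdot)$-growth: there are measurable functions $a\le b$ on $\mathbb{R}^n$, with $a\ge a_->0$ and $b\le b^+<\infty$ for some constants $a_-$, $b^+$, such that for all $(x,t,\xi)$ $$\langle \mathcal{A}(x,t,\xi),\xi\rangle\ge a(x)|\xi|^{p(x)},\qquad |\mathcal{A}(x,t,\xi)|\le b(x)|\xi|^{p(x)-1}.$$ Let $u$ be a bounded $\mathcal{A}$-harmonic function in $\mathbb{R}^n$, i.e. a bounded continuous function $u\in W^{1,p(\cdot)}_{loc}(\mathbb{R}^n)$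 with $$\int_{\mathbb{R}^n}\langle\mathcal{A}(x,u,\nabla u),\nabla\phi\rangle\,dx=0\qquad\text{for all }\phi\in C_0^\infty(\mathbb{R}^n).$$ (Here $u\in W^{1,p(\cdot)}_{loc}(\mathbb{R}^n)$ means that $u$ has a distributional gradient $\nabla u$ and that $u,\nabla u\in L^{p(\cdot)}(K)$ for every compact $K\subset\mathbb{R}^n$, where $f\in L^{p(\cdot)}(K)$ means that $f$ is measurable and $\int_K|f/\mu|^{p(x)}\,dx<\infty$ for some $\mu>0$.) Let $\alpha\in\mathbb{R}$ satisfy $\alpha>\frac{n}{p^-}-1$. Suppose that there are a point $x_0\in\mathbb{R}^n$, a constant $c$ and an increasing sequence of radii $R_k>0$ with $R_k\to\infty$ such that, for every $k$, $$|u(x)|\le \frac{c}{R_k^{\alpha}}\qquad\text{for all }x\in B(x_0,2R_k)\setminus B(x_0,R_k).$$ Then $u$ is constant. -/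

import Mathlib

open MeasureTheory Filter Topology
open scoped ContDiff Gradient

namespace VariableExponent

/-- `p⁻ = ess inf p` over the whole space. It is only used for measurable exponents with values in
`[1, ∞)` that are essentially bounded; there the real-valued essential infimum has its usual
meaning. -/
noncomputable def pMinus {n : ℕ} (p : EuclideanSpace ℝ (Fin n) → ℝ) : ℝ :=
  essInf p volume

/-- `f` is log-Hölder continuous on the whole space:
`|f x - f y| ≤ L / log (e + 1 / |x - y|)` for some constant `L > 0`.
(For `x = y` the left-hand side vanishes and the inequality is automatic.) -/
def LogHolder {n : ℕ} (f : EuclideanSpace ℝ (Fin n) → ℝ) : Prop :=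
  ∃ L : ℝ, 0 < L ∧ ∀ x y, |f x - f y| ≤ L / Real.log (Real.exp 1 + 1 / ‖x - y‖)

/-- A bounded log-Hölder continuous variable exponent on `ℝⁿ`: a measurable function with values
in `[1, ∞)` such that `1 / p` is log-Hölder continuous and `1 < p⁻ ≤ p⁺ < ∞`. -/
structure IsExponent {n : ℕ} (p : EuclideanSpace ℝ (Fin n) → ℝ) : Prop where
  measurable : Measurable p
  one_le : ∀ x, 1 ≤ p x
  logHolder : LogHolder (fun x => 1 / p x)
  one_lt_pMinus : 1 < pMinus p
  essBdd : ∃ P : ℝ, ∀ᵐ x ∂(volume : Measure (EuclideanSpace ℝ (Fin n))), p x ≤ P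

/-- The modular `∫_s |f|^{p(x)} dx`. -/
noncomputable def modular {n : ℕ} {F : Type*} [NormedAddCommGroup F]
    (p : EuclideanSpace ℝ (Fin n) → ℝ) (s : Set (EuclideanSpace ℝ (Fin n)))
    (f : EuclideanSpace ℝ (Fin n) → F) : ENNReal :=
  ∫⁻ x in s, ENNReal.ofReal (‖f x‖ ^ p x)

/-- Membership in the variable exponent Lebesgue space `L^{p(·)}(s)`: the function is measurable
and the modular of `f / μ` is finite for some `μ > 0`. -/
def MemLpVar {n : ℕ} {F : Type*} [NormedAddCommGroup F] [NormedSpace ℝ F]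
    (p : EuclideanSpace ℝ (Fin n) → ℝ) (s : Set (EuclideanSpace ℝ (Fin n)))
    (f : EuclideanSpace ℝ (Fin n) → F) : Prop :=
  AEStronglyMeasurable f (volume.restrict s) ∧
    ∃ μ : ℝ, 0 < μ ∧ modular p s (fun x => μ⁻¹ • f x) < ⊤

/-- The class `C₀^∞(ℝⁿ)` of smooth compactly supported test functions. -/
def IsTest {n : ℕ} (φ : EuclideanSpace ℝ (Fin n) → ℝ) : Prop :=
  ContDiff ℝ ∞ φ ∧ HasCompactSupport φ

/-- `G` is the distributional gradient of `u` on `ℝⁿ`: both are locally integrable and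
`∫ u ∇φ = - ∫ φ G` for all test functions `φ`. -/
structure HasWeakGradient {n : ℕ} (u : EuclideanSpace ℝ (Fin n) → ℝ)
    (G : EuclideanSpace ℝ (Fin n) → EuclideanSpace ℝ (Fin n)) : Prop where
  locInt : LocallyIntegrable u volume
  locInt_grad : LocallyIntegrable G volume
  integral_eq : ∀ φ : EuclideanSpace ℝ (Fin n) → ℝ, IsTest φ →
    ∫ x, u x • ∇ φ x = - ∫ x, φ x • G x

/-- `u ∈ W^{1,p(·)}_loc(ℝⁿ)` with distributional gradient `G`. -/
structure MemSobolevLoc {n : ℕ} (p : EuclideanSpace ℝ (Fin n) → ℝ)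
    (u : EuclideanSpace ℝ (Fin n) → ℝ)
    (G : EuclideanSpace ℝ (Fin n) → EuclideanSpace ℝ (Fin n)) : Prop where
  weakGradient : HasWeakGradient u G
  memLp : ∀ K, IsCompact K → MemLpVar p K u
  memLp_grad : ∀ K, IsCompact K → MemLpVar p K G

/-- `A : ℝⁿ × ℝ × ℝⁿ → ℝⁿ` is a Carathéodory function: (Lebesgue) measurable in the first argument
and continuous in the other two. -/
structure IsCaratheodory {n : ℕ}
    (A : EuclideanSpace ℝ (Fin n) → ℝ → EuclideanSpace ℝ (Fin n) → EuclideanSpace ℝ (Fin n)) :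
    Prop where
  measurable : ∀ t ξ, AEMeasurable (fun x => A x t ξ) volume
  continuous : ∀ x, Continuous (fun q : ℝ × EuclideanSpace ℝ (Fin n) => A x q.1 q.2)

/-- A Carathéodory function of nonstandard growth (`p(·)`-growth). -/
structure HasGrowth {n : ℕ} (p : EuclideanSpace ℝ (Fin n) → ℝ)
    (A : EuclideanSpace ℝ (Fin n) → ℝ → EuclideanSpace ℝ (Fin n) → EuclideanSpace ℝ (Fin n)) :
    Prop where
  caratheodory : IsCaratheodory A
  growth : ∃ a b : EuclideanSpace ℝ (Fin n) → ℝ,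
    AEMeasurable a volume ∧ AEMeasurable b volume ∧
    (∃ aMinus : ℝ, 0 < aMinus ∧ ∀ x, aMinus ≤ a x) ∧
    (∀ x, a x ≤ b x) ∧
    (∃ bPlus : ℝ, ∀ x, b x ≤ bPlus) ∧
    (∀ x t ξ, a x * ‖ξ‖ ^ p x ≤ inner ℝ (A x t ξ) ξ) ∧
    (∀ x t ξ, ‖A x t ξ‖ ≤ b x * ‖ξ‖ ^ (p x - 1))

/-- `u` is `A`-harmonic in `ℝⁿ`: a continuous weak solution `u ∈ W^{1,p(·)}_loc(ℝⁿ)` of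
`div A(x, u, ∇u) = 0`. -/
structure IsHarmonic {n : ℕ} (p : EuclideanSpace ℝ (Fin n) → ℝ)
    (A : EuclideanSpace ℝ (Fin n) → ℝ → EuclideanSpace ℝ (Fin n) → EuclideanSpace ℝ (Fin n))
    (u : EuclideanSpace ℝ (Fin n) → ℝ) : Prop where
  continuous : Continuous u
  weakSolution : ∃ G : EuclideanSpace ℝ (Fin n) → EuclideanSpace ℝ (Fin n),
    MemSobolevLoc p u G ∧
    ∀ φ : EuclideanSpace ℝ (Fin n) → ℝ, IsTest φ →
      ∫ x, inner ℝ (A x (u x) (G x)) (∇ φ x) = 0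

end VariableExponent

open scoped Convolution

namespace VariableExponent

/-! ### Scalar inequalities for powers -/

section Elementary

/-! The argument is a Caccioppoli estimate followed by a count of powers of `R k`. Testing the
equation with `η ^ m * u`, where `η` cuts off between the balls of radius `R k` and `2 * R k` and
`m` is an integer above `sup p`, ellipticity and Young's inequality give `∫ η^m |∇u|^p ≤ ∫ (Γ |u|
|∇η|)^p` (`exists_caccioppoli`). On the annulus `|∇η|` is of order `1/R` and `|u|` of order
`R^{-α}`; elsewhere `∇η = 0`. Once the base `T R^{-(α+1)}` is at most `1`, the exponent may be
lowered to `p⁻`, so the right side is `O(R^{n-(α+1)p⁻})`, which tends to `0` by the choice of `α`.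
Hence `∇u = 0` almost everywhere (`ae_gradient_eq_zero`), and mollification shows that `u` is
constant (`HasWeakGradient.eq_of_ae_zero`).

The delicate point is that `η ^ m * u` is not smooth. It is replaced by its mollifications, and the
limit is taken in the equation (`integral_inner_test_mul_eq_zero`). This rests on a pointwise bound
of `|ρ_k * F|^p` by a constant times `ρ_k * |F|^p + 1` (`IsExponent.norm_integral_rpow_le`), where
log-Hölder continuity enters, and on dominated convergence with varying majorants
(`tendsto_integral_of_tendsto_bound`). -/

theorem rpow_sub_one_mul_le {t s q : ℝ} (ht : 0 ≤ t) (hs : 0 ≤ s) (hq : 1 ≤ q) :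
    t ^ (q - 1) * s ≤ t ^ q + s ^ q := by
  rcases le_total s t with h | h
  · have : t ^ (q - 1) * s ≤ t ^ q := by
      rcases ht.eq_or_lt with rfl | ht'
      · have : s = 0 := le_antisymm h hs
        subst this; simp; positivity
      · calc t ^ (q - 1) * s ≤ t ^ (q - 1) * t := by gcongr
          _ = t ^ q := by rw [← Real.rpow_add_one ht'.ne']; ring_nf
    have := Real.rpow_nonneg hs q
    linarith
  · have : t ^ (q - 1) * s ≤ s ^ q := by
      rcases hs.eq_or_lt with rfl | hs'
      · simp; positivity
      · calc t ^ (q - 1) * s ≤ s ^ (q - 1) * s := by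
              gcongr
          _ = s ^ q := by rw [← Real.rpow_add_one hs'.ne']; ring_nf
    have := Real.rpow_nonneg ht q
    linarith

/-- Young's inequality with a small parameter `δ` and a weight `η ∈ [0, 1]`. -/
theorem young_weighted {η t s q δ : ℝ} {m : ℕ} (hη : 0 ≤ η) (hη1 : η ≤ 1) (ht : 0 ≤ t)
    (hs : 0 ≤ s) (hq : 1 ≤ q) (hm : q ≤ m) (hδ : 0 < δ) :
    η ^ (m - 1) * t ^ (q - 1) * s ≤ δ * (η ^ m * t ^ q) + δ * (s / δ) ^ q := by
  have hm1 : 1 ≤ m := by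
    have : (1 : ℝ) ≤ m := hq.trans hm
    exact_mod_cast this
  have hsδ : 0 ≤ s / δ := by positivity
  set r := s / δ with hr
  have hs' : s = δ * r := by rw [hr]; field_simp
  have key : η ^ (m - 1) * t ^ (q - 1) * r ≤ η ^ m * t ^ q + r ^ q := by
    -- Splitting at `η * t` rather than at `t` leaves the full weight `η ^ m` in the first case. In
    -- the second, `q ≤ m` allows `η ^ (m - 1) ≤ η ^ (q - 1)`, which combines with `t ^ (q - 1)`
    -- into a power of `η * t ≤ r`.
    rcases le_total r (η * t) with h | h
    · have : η ^ (m - 1) * t ^ (q - 1) * r ≤ η ^ m * t ^ q := by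
        rcases ht.eq_or_lt with rfl | ht'
        · have : r = 0 := le_antisymm (by simpa using h) hsδ
          rw [this]; simp; positivity
        · calc η ^ (m - 1) * t ^ (q - 1) * r ≤ η ^ (m - 1) * t ^ (q - 1) * (η * t) := by gcongr
            _ = (η ^ (m - 1) * η) * (t ^ (q - 1) * t) := by ring
            _ = η ^ m * t ^ q := by
              rw [← Real.rpow_add_one ht'.ne', ← pow_succ, Nat.sub_add_cancel hm1]; ring_nf
      have := Real.rpow_nonneg hsδ q
      linarith
    · have : η ^ (m - 1) * t ^ (q - 1) * r ≤ r ^ q := by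
        have h1 : η ^ (m - 1) ≤ η ^ (q - 1) := by
          rcases hη.eq_or_lt with rfl | hη'
          · rcases Nat.eq_or_lt_of_le hm1 with h1 | h1
            · have : q = 1 := le_antisymm (by rw [← h1] at hm; simpa using hm) hq
              subst this; subst h1; simp
            · rw [zero_pow (by omega)]; positivity
          · rw [← Real.rpow_natCast]
            apply Real.rpow_le_rpow_of_exponent_ge hη' hη1
            rw [Nat.cast_sub hm1]; push_cast; linarith
        rcases hsδ.eq_or_lt with h0 | h0
        · rw [← h0]; simp; positivity
        · calc η ^ (m - 1) * t ^ (q - 1) * r ≤ η ^ (q - 1) * t ^ (q - 1) * r := by gcongr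
            _ = (η * t) ^ (q - 1) * r := by rw [Real.mul_rpow hη ht]
            _ ≤ r ^ (q - 1) * r := by gcongr
            _ = r ^ q := by rw [← Real.rpow_add_one h0.ne']; ring_nf
      have : 0 ≤ η ^ m * t ^ q := by positivity
      linarith
  rw [hs']
  calc η ^ (m - 1) * t ^ (q - 1) * (δ * r) = δ * (η ^ (m - 1) * t ^ (q - 1) * r) := by ring
    _ ≤ δ * (η ^ m * t ^ q + r ^ q) := by gcongr
    _ = _ := by ring

/-- The tangent to `t ↦ t ^ r` at `a` lies below the graph. -/
theorem tangent_le_rpow {a t r : ℝ} (ha : 0 < a) (ht : 0 ≤ t) (hr : 1 ≤ r) :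
    a ^ r + r * a ^ (r - 1) * (t - a) ≤ t ^ r := by
  have h1 : -1 ≤ t / a - 1 := by
    have : 0 ≤ t / a := by positivity
    linarith
  have h2 := one_add_mul_self_le_rpow_one_add h1 hr
  have h3 : (1 + (t / a - 1)) ^ r = t ^ r / a ^ r := by
    rw [← Real.div_rpow ht ha.le]; ring_nf
  rw [h3, le_div_iff₀ (by positivity)] at h2
  have h4 : a ^ r = a ^ (r - 1) * a := by
    rw [← Real.rpow_add_one ha.ne']; ring_nf
  calc a ^ r + r * a ^ (r - 1) * (t - a) = (1 + r * (t / a - 1)) * a ^ r := by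
        rw [h4]; field_simp
    _ ≤ _ := h2

/-- Raising the exponent can only lose where `t ≤ 1`, and there the loss is at most `1`. This lets a
constant exponent below `p` replace `p` in Jensen's inequality. -/
theorem rpow_le_rpow_add_one {t r q : ℝ} (ht : 0 ≤ t) (hr : 0 ≤ r) (hrq : r ≤ q) :
    t ^ r ≤ t ^ q + 1 := by
  rcases le_total t 1 with h | h
  · have := Real.rpow_le_one ht h hr
    have := Real.rpow_nonneg ht q
    linarith
  · have := Real.rpow_le_rpow_of_exponent_le h hrq
    linarith

theorem mul_add_one_rpow_le {C t q P : ℝ} (hC : 1 ≤ C) (ht : 0 ≤ t) (hq : 0 ≤ q) (hqP : q ≤ P) :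
    (C * (t + 1)) ^ q ≤ (2 * C) ^ P * (t ^ q + 1) := by
  have h1 : (2 * C) ^ q ≤ (2 * C) ^ P := Real.rpow_le_rpow_of_exponent_le (by linarith) hqP
  have h2 : (max t 1) ^ q ≤ t ^ q + 1 := by
    have := Real.rpow_nonneg ht q
    rcases le_total t 1 with h | h
    · rw [max_eq_right h]; simp; linarith
    · rw [max_eq_left h]; linarith
  calc (C * (t + 1)) ^ q ≤ (2 * C * max t 1) ^ q := by
        apply Real.rpow_le_rpow (by positivity) _ hq
        have := le_max_left t 1
        have := le_max_right t 1
        nlinarith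
    _ = (2 * C) ^ q * (max t 1) ^ q := Real.mul_rpow (by linarith) (by positivity)
    _ ≤ _ := by gcongr

end Elementary

/-! ### Limits of integrals and measurability of superpositions -/

section Integration

variable {X : Type*} [MeasurableSpace X] {μ : Measure X}

/-- Dominated convergence with a convergent sequence of dominating functions. -/
theorem tendsto_integral_of_tendsto_bound {f : ℕ → X → ℝ} {f₀ : X → ℝ} {g : ℕ → X → ℝ}
    {g₀ : X → ℝ} (hf : ∀ k, AEStronglyMeasurable (f k) μ)
    (hg : ∀ k, Integrable (g k) μ) (hg₀ : Integrable g₀ μ)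
    (hfg : ∀ k, ∀ᵐ x ∂μ, |f k x| ≤ g k x)
    (hlim : ∀ᵐ x ∂μ, Tendsto (fun k => f k x) atTop (𝓝 (f₀ x)))
    (hglim : ∀ᵐ x ∂μ, Tendsto (fun k => g k x) atTop (𝓝 (g₀ x)))
    (hgint : Tendsto (fun k => ∫ x, g k x ∂μ) atTop (𝓝 (∫ x, g₀ x ∂μ))) :
    Tendsto (fun k => ∫ x, f k x ∂μ) atTop (𝓝 (∫ x, f₀ x ∂μ)) := by
  have hfg' : ∀ᵐ x ∂μ, ∀ k, |f k x| ≤ g k x := ae_all_iff.2 hfg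
  have hfint : ∀ k, Integrable (f k) μ := fun k =>
    (hg k).mono' (hf k) (by simpa [Real.norm_eq_abs] using hfg k)
  have hg₀nn : ∀ᵐ x ∂μ, 0 ≤ g₀ x := by
    filter_upwards [hfg', hglim] with x h1 h2
    exact ge_of_tendsto' h2 fun k => (abs_nonneg _).trans (h1 k)
  have hf₀ : ∀ᵐ x ∂μ, |f₀ x| ≤ g₀ x := by
    filter_upwards [hfg', hlim, hglim] with x h1 h2 h3
    exact le_of_tendsto_of_tendsto' h2.abs h3 h1
  -- Truncating `f k` to `[-g₀, g₀]` makes ordinary dominated convergence applicable. The part cut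
  -- off is at most `g k - min (g k) g₀`, whose integral vanishes in the limit because the integrals
  -- of `g k` and of `min (g k) g₀` both tend to that of `g₀`.
  have hmin : ∀ k, Integrable (fun x => min (g k x) (g₀ x)) μ := fun k => (hg k).inf hg₀
  have hmax : ∀ k, Integrable (fun x => max (-g₀ x) (min (f k x) (g₀ x))) μ := fun k =>
    hg₀.neg.sup ((hfint k).inf hg₀)
  have hm : Tendsto (fun k => ∫ x, min (g k x) (g₀ x) ∂μ) atTop (𝓝 (∫ x, g₀ x ∂μ)) := by
    refine tendsto_integral_of_dominated_convergence g₀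
      (fun k => (hmin k).aestronglyMeasurable) hg₀ (fun k => ?_) ?_
    · filter_upwards [hfg', hg₀nn] with x h1 h2
      rw [Real.norm_eq_abs, abs_of_nonneg (le_min ((abs_nonneg _).trans (h1 k)) h2)]
      exact min_le_right _ _
    · filter_upwards [hglim] with x h
      simpa using h.min (tendsto_const_nhds (x := g₀ x))
  have hh : Tendsto (fun k => ∫ x, max (-g₀ x) (min (f k x) (g₀ x)) ∂μ) atTop
      (𝓝 (∫ x, f₀ x ∂μ)) := by
    refine tendsto_integral_of_dominated_convergence g₀
      (fun k => (hmax k).aestronglyMeasurable) hg₀ (fun k => ?_) ?_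
    · filter_upwards [hg₀nn] with x h2
      rw [Real.norm_eq_abs, abs_le]
      exact ⟨le_max_left _ _, max_le (by linarith) (min_le_right _ _)⟩
    · filter_upwards [hlim, hf₀] with x h h0
      have := (tendsto_const_nhds (x := -g₀ x)).max (h.min (tendsto_const_nhds (x := g₀ x)))
      rw [abs_le] at h0
      rwa [min_eq_left h0.2, max_eq_right h0.1] at this
  have hd : Tendsto (fun k => ∫ x, f k x - max (-g₀ x) (min (f k x) (g₀ x)) ∂μ) atTop (𝓝 0) := by
    have hz : Tendsto (fun k => ∫ x, g k x - min (g k x) (g₀ x) ∂μ) atTop (𝓝 0) := by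
      have := hgint.sub hm
      rw [sub_self] at this
      refine this.congr fun k => ?_
      rw [integral_sub (hg k) (hmin k)]
    refine squeeze_zero_norm (fun k => ?_) hz
    refine norm_integral_le_of_norm_le ((hg k).sub (hmin k)) ?_
    filter_upwards [hfg', hg₀nn] with x h1 h2
    have h3 := abs_le.1 (h1 k)
    rw [Real.norm_eq_abs, abs_le]
    rcases le_total (f k x) (g₀ x) with h | h <;> rcases le_total (g k x) (g₀ x) with h' | h' <;>
    rcases le_total (-g₀ x) (f k x) with h'' | h'' <;>
    simp only [h, h', h'', min_eq_left, min_eq_right, max_eq_left, max_eq_right] <;>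
    (try rw [max_eq_right (by linarith)]) <;>
    constructor <;> linarith
  have := hd.add hh
  rw [zero_add] at this
  refine this.congr fun k => ?_
  rw [integral_sub (hfint k) (hmax k), sub_add_cancel]

/-- Superposition with a Carathéodory function preserves almost everywhere measurability. -/
theorem aemeasurable_comp_of_continuous {Y Z : Type*} [TopologicalSpace Y]
    [TopologicalSpace.PseudoMetrizableSpace Y] [MeasurableSpace Y] [BorelSpace Y]
    [SecondCountableTopology Y]
    [NormedAddCommGroup Z] [MeasurableSpace Z] [BorelSpace Z] [SecondCountableTopology Z]
    {B : X → Y → Z} (hB : ∀ y, AEMeasurable (fun x => B x y) μ) (hc : ∀ x, Continuous (B x))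
    {g : X → Y} (hg : AEMeasurable g μ) : AEMeasurable (fun x => B x (g x)) μ := by
  obtain ⟨g', hg', hgg'⟩ := hg
  suffices h : AEMeasurable (fun x => B x (g' x)) μ by
    refine h.congr ?_
    filter_upwards [hgg'] with x hx
    rw [hx]
  have hs := hg'.stronglyMeasurable
  refine aemeasurable_of_tendsto_metrizable_ae atTop (f := fun k x => B x (hs.approx k x))
    (fun k => ?_) (ae_of_all _ fun x => ((hc x).tendsto _).comp (hs.tendsto_approx x))
  -- On each fibre of the simple function the second argument of `B` is frozen, so only
  -- measurability in `x` is needed; continuity then handles the limit in `k`.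
  have : (fun x => B x (hs.approx k x)) = fun x => ∑ y ∈ (hs.approx k).range,
      ((hs.approx k) ⁻¹' {y}).indicator (fun x => B x y) x := by
    ext x
    rw [Finset.sum_eq_single (hs.approx k x)]
    · simp
    · intro y _ hy
      simp [Set.indicator_of_notMem, hy.symm]
    · intro h
      exact absurd (SimpleFunc.mem_range_self _ x) h
  rw [this]
  exact Finset.aemeasurable_fun_sum _ fun y _ =>
    (hB y).indicator ((hs.approx k).measurableSet_fiber y)

end Integration

/-! ### Continuity and pointwise bounds of the exponent -/

section Exponent

variable {n : ℕ} {p f : EuclideanSpace ℝ (Fin n) → ℝ}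

theorem one_le_log_exp_one_add {t : ℝ} (ht : 0 ≤ t) : 1 ≤ Real.log (Real.exp 1 + t) := by
  rw [Real.le_log_iff_exp_le (by positivity)]
  linarith

theorem LogHolder.continuous (hf : LogHolder f) : Continuous f := by
  obtain ⟨L, hL, h⟩ := hf
  rw [continuous_iff_continuousAt]
  intro y
  -- The point `x = y` must be removed: with `1 / 0 = 0` the modulus equals `L` there instead of
  -- being small.
  rw [continuousAt_iff_punctured_nhds, tendsto_iff_norm_sub_tendsto_zero]
  refine squeeze_zero (fun _ => norm_nonneg _) (fun x => h x y) ?_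
  refine Tendsto.div_atTop tendsto_const_nhds (Real.tendsto_log_atTop.comp ?_)
  refine tendsto_atTop_add_const_left _ _ ?_
  simp only [one_div]
  refine Tendsto.inv_tendsto_nhdsGT_zero ?_
  exact tendsto_norm_sub_self_nhdsNE y

theorem IsExponent.continuous (hp : IsExponent p) : Continuous p := by
  have h := hp.logHolder.continuous.inv₀ fun x => by
    have := hp.one_le x
    positivity
  refine h.congr fun x => ?_
  simp

/-- A set of full measure is dense, so continuity of `p` upgrades an almost everywhere bound to
every point; the same holds for the lower bound `p⁻`. -/
theorem IsExponent.exists_le (hp : IsExponent p) : ∃ P : ℝ, ∀ x, p x ≤ P := by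
  obtain ⟨P, hP⟩ := hp.essBdd
  refine ⟨P, fun x => ?_⟩
  have hd := Measure.dense_of_ae hP
  have hc : IsClosed {x | p x ≤ P} := isClosed_le hp.continuous continuous_const
  have := hc.closure_eq ▸ hd x
  exact this

theorem IsExponent.pMinus_le (hp : IsExponent p) (x : EuclideanSpace ℝ (Fin n)) :
    pMinus p ≤ p x := by
  have hae : ∀ᵐ x, pMinus p ≤ p x :=
    ae_essInf_le (isBoundedUnder_of ⟨1, hp.one_le⟩)
  have hd := Measure.dense_of_ae hae
  have hc : IsClosed {x | pMinus p ≤ p x} := isClosed_le continuous_const hp.continuous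
  have := hc.closure_eq ▸ hd x
  exact this

end Exponent

/-! ### Jensen's inequality and mollification for a log-Hölder exponent -/

section Mollify

variable {n : ℕ} {p : EuclideanSpace ℝ (Fin n) → ℝ}
  {F : Type*} [NormedAddCommGroup F] [NormedSpace ℝ F]

/-- Jensen's inequality for a weight `w` concentrated on a set where the variable exponent is at
least `r`. -/
theorem integral_weight_rpow_le {w : EuclideanSpace ℝ (Fin n) → ℝ}
    {f : EuclideanSpace ℝ (Fin n) → ℝ} {r : ℝ} (hr : 1 ≤ r)
    (hw : ∀ y, 0 ≤ w y) (hwi : Integrable w) (hw1 : ∫ y, w y = 1)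
    (hf : ∀ y, 0 ≤ f y) (hpr : ∀ y, w y ≠ 0 → r ≤ p y)
    (hwf : Integrable fun y => w y * f y) (hwp : Integrable fun y => w y * f y ^ p y) :
    (∫ y, w y * f y) ^ r ≤ (∫ y, w y * f y ^ p y) + 1 := by
  set a := ∫ y, w y * f y with ha
  have ha0 : 0 ≤ a := integral_nonneg fun y => mul_nonneg (hw y) (hf y)
  have hI : 0 ≤ ∫ y, w y * f y ^ p y :=
    integral_nonneg fun y => mul_nonneg (hw y) (Real.rpow_nonneg (hf y) _)
  rcases ha0.eq_or_lt with h0 | h0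
  · rw [← h0, Real.zero_rpow (by linarith)]; linarith
  -- Tangent to `t ^ r` at the mean `a`: the linear term integrates to zero. Passing from `r` to `p
  -- y` costs `w y`, of total mass `1`.
  have hpt : ∀ y, w y * a ^ r + r * a ^ (r - 1) * (w y * f y - w y * a) ≤
      w y * f y ^ p y + w y := by
    intro y
    by_cases hy : w y = 0
    · simp [hy]
    · have h1 := tangent_le_rpow h0 (hf y) hr
      have h2 := rpow_le_rpow_add_one (hf y) (by linarith : 0 ≤ r) (hpr y hy)
      calc w y * a ^ r + r * a ^ (r - 1) * (w y * f y - w y * a)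
          = w y * (a ^ r + r * a ^ (r - 1) * (f y - a)) := by ring
        _ ≤ w y * (f y ^ p y + 1) := mul_le_mul_of_nonneg_left (h1.trans h2) (hw y)
        _ = _ := by ring
  have hint := integral_mono
    ((hwi.mul_const (a ^ r)).add ((hwf.sub (hwi.mul_const a)).const_mul (r * a ^ (r - 1))))
    (hwp.add hwi) hpt
  simp only [Pi.add_apply, Pi.sub_apply] at hint
  have hsub : Integrable fun y => w y * f y - w y * a := hwf.sub (hwi.mul_const a)
  rw [integral_add (hwi.mul_const _) (hsub.const_mul _),
    integral_const_mul, integral_sub hwf (hwi.mul_const a), integral_add hwp hwi,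
    integral_mul_const, integral_mul_const, hw1, ← ha] at hint
  simpa using hint

/-- The pointwise estimate behind the boundedness of mollification in `L^{p(·)}`. -/
theorem IsExponent.norm_integral_rpow_le (hp : IsExponent p) {C M : ℝ} (hC : 0 ≤ C)
    (hM : 0 ≤ M) :
    ∃ K : ℝ, 0 ≤ K ∧ ∀ ε : ℝ, 0 < ε → ε ≤ 1 →
      ∀ (w : EuclideanSpace ℝ (Fin n) → ℝ) (f : EuclideanSpace ℝ (Fin n) → F)
        (x : EuclideanSpace ℝ (Fin n)),
      (∀ y, 0 ≤ w y) → Integrable w → ∫ y, w y = 1 → (∀ y, w y ≤ C * (1 / ε) ^ n) →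
      (∀ y, w y ≠ 0 → ‖x - y‖ ≤ ε) → Integrable (fun y => w y • f y) →
      Integrable (fun y => ‖f y‖ ^ p y) → ∫ y, ‖f y‖ ^ p y ≤ M →
      ‖∫ y, w y • f y‖ ^ p x ≤ K * ((∫ y, w y * ‖f y‖ ^ p y) + 1) := by
  obtain ⟨P, hP⟩ := hp.exists_le
  obtain ⟨L, hL, hLH⟩ := hp.logHolder
  have hP0 : 0 ≤ P := by linarith [hP 0, hp.one_le 0]
  refine ⟨(C * M + 1) ^ (P * L) * Real.exp (n * P * L), by positivity, ?_⟩
  intro ε hε hε1 w f x hw hwi hw1 hwC hwε hwf hfp hfM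
  set T := Real.exp 1 + 1 / ε with hT
  have hT1 : 1 ≤ Real.log T := one_le_log_exp_one_add (by positivity)
  have hTpos : 0 < T := by positivity
  set lam := L / Real.log T with hlam
  have hlam0 : 0 ≤ lam := by positivity
  have hlamL : lam ≤ L := div_le_self hL.le hT1
  have hpx := hp.one_le x
  have hpx0 : 0 < p x := by linarith
  -- By log-Hölder continuity `1 / p y ≤ 1 / p x + lam` within distance `ε` of `x`, so `r` bounds
  -- `p` from below on the support of `w`. The maximum with `1` keeps Jensen's inequality available.
  set r := max 1 (1 / (1 / p x + lam)) with hr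
  have hr1 : 1 ≤ r := le_max_left _ _
  have hr0 : 0 < r := by linarith
  have hpr : ∀ y, w y ≠ 0 → r ≤ p y := by
    intro y hy
    have hpy := hp.one_le y
    refine max_le hpy ?_
    have h1 : 1 / p y ≤ 1 / p x + lam := by
      rcases eq_or_ne x y with rfl | hxy
      · linarith
      · have hn : 0 < ‖x - y‖ := norm_pos_iff.2 (sub_ne_zero.2 hxy)
        have h2 : L / Real.log (Real.exp 1 + 1 / ‖x - y‖) ≤ lam := by
          rw [hlam]
          have : 1 / ε ≤ 1 / ‖x - y‖ := one_div_le_one_div_of_le hn (hwε y hy)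
          rw [hT]
          gcongr
        have := (abs_le.1 (hLH x y)).1
        linarith
    rw [div_le_iff₀ (by positivity)]
    rw [div_le_iff₀ (by linarith)] at h1
    linarith
  have hwp : Integrable fun y => w y * ‖f y‖ ^ p y := by
    refine hfp.bdd_mul hwi.aestronglyMeasurable (c := C * (1 / ε) ^ n) (ae_of_all _ fun y => ?_)
    rw [Real.norm_of_nonneg (hw y)]
    exact hwC y
  have hwfn : Integrable fun y => w y * ‖f y‖ := by
    refine hwf.norm.congr (ae_of_all _ fun y => ?_)
    simp [norm_smul, abs_of_nonneg (hw y)]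
  have hJ := integral_weight_rpow_le hr1 hw hwi hw1 (fun y => norm_nonneg (f y)) hpr hwfn hwp
  set I := (∫ y, w y * ‖f y‖ ^ p y) + 1 with hI
  have hI1 : 1 ≤ I := by
    have : 0 ≤ ∫ y, w y * ‖f y‖ ^ p y :=
      integral_nonneg fun y => mul_nonneg (hw y) (Real.rpow_nonneg (norm_nonneg _) _)
    linarith
  -- A bound polynomial in `1 / ε` suffices, since it is only raised to the small power `P * lam`,
  -- the excess of `p x / r` over `1`.
  have hI2 : I ≤ (C * M + 1) * T ^ n := by
    have h1 : ∫ y, w y * ‖f y‖ ^ p y ≤ C * (1 / ε) ^ n * M := by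
      calc ∫ y, w y * ‖f y‖ ^ p y ≤ ∫ y, C * (1 / ε) ^ n * ‖f y‖ ^ p y := by
            refine integral_mono hwp (hfp.const_mul _) fun y => ?_
            have := Real.rpow_nonneg (norm_nonneg (f y)) (p y)
            exact mul_le_mul_of_nonneg_right (hwC y) this
        _ = C * (1 / ε) ^ n * ∫ y, ‖f y‖ ^ p y := integral_const_mul _ _
        _ ≤ _ := by gcongr
    have h2 : (1 / ε) ^ n ≤ T ^ n := by
      have : 1 / ε ≤ T := by rw [hT]; linarith [Real.exp_pos 1]
      gcongr
    have h3 : 1 ≤ T ^ n := one_le_pow₀ (by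
      have := Real.add_one_le_exp 1
      have : 0 < 1 / ε := by positivity
      linarith)
    have h4 : C * (1 / ε) ^ n * M ≤ C * T ^ n * M := by gcongr
    nlinarith
  have ha : ‖∫ y, w y • f y‖ ≤ ∫ y, w y * ‖f y‖ := by
    refine (norm_integral_le_integral_norm _).trans_eq ?_
    congr 1
    ext y
    simp [norm_smul, abs_of_nonneg (hw y)]
  set a := ∫ y, w y * ‖f y‖ with ha'
  have ha0 : 0 ≤ a := (norm_nonneg _).trans ha
  have hexp : p x / r ≤ 1 + P * lam := by
    have h1 : 1 ≤ r * (1 / p x + lam) := by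
      rw [← div_le_iff₀ (by positivity)]
      exact le_max_right _ _
    rw [div_le_iff₀ hr0]
    have h2 : p x * lam ≤ P * lam := by gcongr; exact hP x
    calc p x = p x * 1 := (mul_one _).symm
      _ ≤ p x * (r * (1 / p x + lam)) := by gcongr
      _ = (1 + p x * lam) * r := by field_simp
      _ ≤ _ := by gcongr
  have hCM : 1 ≤ C * M + 1 := by
    have : 0 ≤ C * M := by positivity
    linarith
  calc ‖∫ y, w y • f y‖ ^ p x ≤ a ^ p x := by gcongr
    _ = (a ^ r) ^ (p x / r) := by
      rw [← Real.rpow_mul ha0]; congr 1; field_simp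
    _ ≤ I ^ (p x / r) := by gcongr
    _ ≤ I ^ (1 + P * lam) := Real.rpow_le_rpow_of_exponent_le hI1 hexp
    _ = I ^ (P * lam) * I := by
      rw [add_comm, Real.rpow_add_one (by linarith)]
    -- As `lam * log T = L`, the factor `T ^ (n * P * lam)` equals `exp (n * P * L)` independently
    -- of `ε`.
    _ ≤ (C * M + 1) ^ (P * L) * Real.exp (n * P * L) * I := by
      gcongr
      calc I ^ (P * lam) ≤ ((C * M + 1) * T ^ n) ^ (P * lam) := by gcongr
        _ = (C * M + 1) ^ (P * lam) * (T ^ n) ^ (P * lam) :=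
          Real.mul_rpow (by linarith) (by positivity)
        _ ≤ _ := by
          gcongr
          · rw [← Real.rpow_natCast, ← Real.rpow_mul hTpos.le, Real.rpow_def_of_pos hTpos]
            apply le_of_eq
            congr 1
            rw [hlam]
            field_simp

end Mollify

/-! ### Weak gradients and mollifiers -/

section Gradient

variable {n : ℕ} {u φ ψ : EuclideanSpace ℝ (Fin n) → ℝ}
  {G : EuclideanSpace ℝ (Fin n) → EuclideanSpace ℝ (Fin n)}

theorem IsTest.differentiable (hφ : IsTest φ) : Differentiable ℝ φ :=
  hφ.1.differentiable (by simp)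

theorem IsTest.continuous_gradient (hφ : IsTest φ) : Continuous (∇ φ) :=
  (InnerProductSpace.toDual ℝ _).symm.continuous.comp (hφ.1.continuous_fderiv (by simp))

theorem IsTest.hasCompactSupport_gradient (hφ : IsTest φ) : HasCompactSupport (∇ φ) :=
  (hφ.2.fderiv ℝ).comp_left (g := (InnerProductSpace.toDual ℝ _).symm) (map_zero _)

theorem gradient_mul {x : EuclideanSpace ℝ (Fin n)} (hφ : DifferentiableAt ℝ φ x)
    (hψ : DifferentiableAt ℝ ψ x) :
    ∇ (fun y => φ y * ψ y) x = φ x • ∇ ψ x + ψ x • ∇ φ x := by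
  simp [gradient, fderiv_fun_mul hφ hψ]

theorem IsTest.mul (hφ : IsTest φ) (hψ : IsTest ψ) : IsTest fun x => φ x * ψ x :=
  ⟨hφ.1.mul hψ.1, hφ.2.mul_right⟩

theorem IsTest.comp_sub_left (hφ : IsTest φ) (x : EuclideanSpace ℝ (Fin n)) :
    IsTest fun y => φ (x - y) :=
  ⟨hφ.1.comp (contDiff_const.sub contDiff_id),
    hφ.2.comp_homeomorph (Homeomorph.subLeft x)⟩

theorem gradient_comp_sub_left (hφ : IsTest φ) (x y : EuclideanSpace ℝ (Fin n)) :
    ∇ (fun z => φ (x - z)) y = - ∇ φ (x - y) := by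
  have h := ((hφ.differentiable (x - y)).hasFDerivAt.comp y
    ((hasFDerivAt_id y).const_sub x)).fderiv
  refine (InnerProductSpace.toDual ℝ _).injective ?_
  rw [toDual_gradient, map_neg, toDual_gradient]
  refine h.trans ?_
  ext v
  simp

/-- The Leibniz rule for the product of a weakly differentiable function and a test function. -/
theorem HasWeakGradient.test_mul (hu : HasWeakGradient u G) (hψ : IsTest ψ) :
    HasWeakGradient (fun x => ψ x * u x) (fun x => ψ x • G x + u x • ∇ ψ x) where
  locInt := by
    simpa using hu.locInt.continuous_smul hψ.1.continuous
  locInt_grad := (hu.locInt_grad.continuous_smul hψ.1.continuous).add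
    (hu.locInt.smul_continuous hψ.continuous_gradient)
  integral_eq φ hφ := by
    have h := hu.integral_eq _ (hφ.mul hψ)
    have h1 : Integrable fun x => u x • (φ x • ∇ ψ x) :=
      hu.locInt.integrable_smul_right_of_hasCompactSupport
        (hφ.1.continuous.smul hψ.continuous_gradient) hφ.2.smul_right
    have h2 : Integrable fun x => u x • (ψ x • ∇ φ x) :=
      hu.locInt.integrable_smul_right_of_hasCompactSupport
        (hψ.1.continuous.smul hφ.continuous_gradient) hψ.2.smul_right
    have h3 : Integrable fun x => (φ x * ψ x) • G x :=
      hu.locInt_grad.integrable_smul_left_of_hasCompactSupport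
        (hφ.1.continuous.mul hψ.1.continuous) (hφ.mul hψ).2
    have e1 : ∀ x, u x • ∇ (fun y => φ y * ψ y) x = u x • (φ x • ∇ ψ x) + u x • (ψ x • ∇ φ x) := by
      intro x
      rw [gradient_mul hφ.differentiable.differentiableAt hψ.differentiable.differentiableAt,
        smul_add]
    simp_rw [e1] at h
    rw [integral_add h1 h2] at h
    have e2 : ∀ x, φ x • (ψ x • G x + u x • ∇ ψ x) = (φ x * ψ x) • G x + u x • (φ x • ∇ ψ x) := by
      intro x
      rw [smul_add, smul_smul, smul_comm (φ x) (u x)]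
    have e3 : ∀ x, (ψ x * u x) • ∇ φ x = u x • (ψ x • ∇ φ x) := by
      intro x
      rw [mul_comm, mul_smul]
    simp_rw [e2, e3]
    rw [integral_add h3 h1, neg_add, ← h]
    abel

/-- Mollification commutes with the weak gradient. -/
theorem HasWeakGradient.gradient_convolution (hu : HasWeakGradient u G) (hφ : IsTest φ)
    (x : EuclideanSpace ℝ (Fin n)) :
    ∇ (φ ⋆[ContinuousLinearMap.lsmul ℝ ℝ, volume] u) x =
      (φ ⋆[ContinuousLinearMap.lsmul ℝ ℝ, volume] G) x := by
  have hd := hφ.2.hasFDerivAt_convolution_right ((ContinuousLinearMap.lsmul ℝ ℝ).flip)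
    hu.locInt (hφ.1.of_le (by simp)) x
  rw [convolution_flip] at hd
  have hint : Integrable fun y => u y • ∇ φ (x - y) :=
    hu.locInt.integrable_smul_right_of_hasCompactSupport
      (hφ.continuous_gradient.comp (by fun_prop))
      (hφ.hasCompactSupport_gradient.comp_homeomorph (Homeomorph.subLeft x))
  -- With the test function `y ↦ φ (x - y)`, the sign from the reflected argument cancels the one
  -- from integration by parts.
  have h := hu.integral_eq _ (hφ.comp_sub_left x)
  simp_rw [gradient_comp_sub_left hφ, smul_neg] at h
  rw [integral_neg, neg_inj] at h
  rw [convolution_eq_swap]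
  simp only [ContinuousLinearMap.lsmul_apply]
  rw [← h]
  refine ext_inner_right ℝ fun v => ?_
  rw [inner_gradient_left, hd.fderiv, convolution_precompR_apply _ hu.locInt (hφ.2.fderiv ℝ)
    (hφ.1.continuous_fderiv (by simp)), real_inner_comm, ← integral_inner hint, convolution_def]
  congr 1
  ext y
  rw [inner_smul_right, real_inner_comm, inner_gradient_left]
  simp [mul_comm]

theorem isTest_convolution (hφ : IsTest φ) (hu : LocallyIntegrable u volume)
    (hc : HasCompactSupport u) :
    IsTest (φ ⋆[ContinuousLinearMap.lsmul ℝ ℝ, volume] u) :=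
  ⟨hφ.2.contDiff_convolution_left _ hφ.1 hu, hφ.2.convolution _ hc⟩

/-- Mollifiers: normalized bump functions of radius `1 / (k + 1)`. -/
noncomputable def bump (n k : ℕ) : ContDiffBump (0 : EuclideanSpace ℝ (Fin n)) where
  rIn := 1 / (2 * ((k : ℝ) + 1))
  rOut := 1 / ((k : ℝ) + 1)
  rIn_pos := by positivity
  rIn_lt_rOut := by
    apply one_div_lt_one_div_of_lt <;> linarith [(Nat.cast_nonneg k : (0 : ℝ) ≤ k)]

theorem tendsto_bump_rOut (n : ℕ) : Tendsto (fun k => (bump n k).rOut) atTop (𝓝 0) :=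
  tendsto_one_div_add_atTop_nhds_zero_nat

theorem bump_rOut_le (n k : ℕ) : (bump n k).rOut ≤ 2 * (bump n k).rIn := by
  simp only [bump]
  apply le_of_eq
  field_simp

theorem bump_rOut_le_one (n k : ℕ) : (bump n k).rOut ≤ 1 := by
  simp only [bump]
  rw [div_le_one (by positivity)]
  linarith [(Nat.cast_nonneg k : (0 : ℝ) ≤ k)]

theorem isTest_bump (n k : ℕ) : IsTest ((bump n k).normed volume) :=
  ⟨(bump n k).contDiff_normed, (bump n k).hasCompactSupport_normed⟩

/-- Comparable inner and outer radii make `C` independent of `k`, giving the height bound that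
`IsExponent.norm_integral_rpow_le` requires of its weight. -/
theorem exists_bump_le (n : ℕ) : ∃ C : ℝ, 0 ≤ C ∧ ∀ k x,
    (bump n k).normed volume x ≤ C * (1 / (bump n k).rOut) ^ n := by
  refine ⟨2 ^ n / volume.real (Metric.ball (0 : EuclideanSpace ℝ (Fin n)) 1), by positivity, ?_⟩
  intro k x
  refine ((bump n k).normed_le_div_measure_closedBall_rOut volume 2 (bump_rOut_le n k) x).trans_eq ?_
  rw [measureReal_def, Measure.addHaar_closedBall _ _ (bump n k).rOut_pos.le]
  have := (bump n k).rOut_pos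
  rw [ENNReal.toReal_mul, ENNReal.toReal_ofReal (by positivity), measureReal_def]
  simp only [finrank_euclideanSpace, Fintype.card_fin, one_div, inv_pow]
  field_simp

/-- A continuous function with vanishing weak gradient is constant. -/
theorem HasWeakGradient.eq_of_ae_zero (hu : HasWeakGradient u G) (hc : Continuous u)
    (hG : ∀ᵐ x, G x = 0) (x y : EuclideanSpace ℝ (Fin n)) : u x = u y := by
  -- The mollifications converge pointwise to `u`, and each is constant, its gradient being the
  -- mollification of `G`.
  have hlim := fun z => ContDiffBump.convolution_tendsto_right_of_continuous (μ := volume)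
    (tendsto_bump_rOut n) hc z
  refine tendsto_nhds_unique (hlim x) ((hlim y).congr fun k => ?_)
  have hd : Differentiable ℝ ((bump n k).normed volume
      ⋆[ContinuousLinearMap.lsmul ℝ ℝ, volume] u) :=
    ((isTest_bump n k).2.contDiff_convolution_left _ (isTest_bump n k).1 hu.locInt).differentiable
      (by simp)
  refine is_const_of_fderiv_eq_zero hd (fun z => ?_) y x
  rw [← toDual_gradient, hu.gradient_convolution (isTest_bump n k), convolution_eq_swap,
    integral_eq_zero_of_ae, map_zero]
  filter_upwards [hG] with t ht
  simp [ht]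

end Gradient

/-! ### Enlarging the class of test functions -/

section WeakFormulation

variable {n : ℕ} {p u : EuclideanSpace ℝ (Fin n) → ℝ}
  {G : EuclideanSpace ℝ (Fin n) → EuclideanSpace ℝ (Fin n)}
  {A : EuclideanSpace ℝ (Fin n) → ℝ → EuclideanSpace ℝ (Fin n) → EuclideanSpace ℝ (Fin n)}

theorem IsExponent.aestronglyMeasurable_norm_rpow (hp : IsExponent p) {F : Type*}
    [NormedAddCommGroup F] {μ : Measure (EuclideanSpace ℝ (Fin n))}
    {f : EuclideanSpace ℝ (Fin n) → F}
    (hf : AEStronglyMeasurable f μ) : AEStronglyMeasurable (fun x => ‖f x‖ ^ p x) μ :=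
  (hf.norm.aemeasurable.pow hp.measurable.aemeasurable).aestronglyMeasurable

/-- Since the exponent is bounded, the modular of an element of `L^{p(·)}` is finite. -/
theorem IsExponent.integrableOn_norm_rpow (hp : IsExponent p) {F : Type*} [NormedAddCommGroup F]
    [NormedSpace ℝ F] {s : Set (EuclideanSpace ℝ (Fin n))} {f : EuclideanSpace ℝ (Fin n) → F}
    (hf : MemLpVar p s f) : IntegrableOn (fun x => ‖f x‖ ^ p x) s := by
  obtain ⟨P, hP⟩ := hp.exists_le
  obtain ⟨hm, μ, hμ, hfin⟩ := hf
  have h1 : Integrable (fun x => ‖μ⁻¹ • f x‖ ^ p x) (volume.restrict s) := by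
    refine ⟨hp.aestronglyMeasurable_norm_rpow (hm.const_smul _), ?_⟩
    rw [hasFiniteIntegral_iff_ofReal (ae_of_all _ fun x => by positivity)]
    exact hfin
  refine (h1.const_mul (max 1 μ ^ P)).mono' (hp.aestronglyMeasurable_norm_rpow hm)
    (ae_of_all _ fun x => ?_)
  rw [Real.norm_of_nonneg (by positivity)]
  have h2 : ‖f x‖ = μ * ‖μ⁻¹ • f x‖ := by
    rw [norm_smul, norm_inv, Real.norm_of_nonneg hμ.le]
    field_simp
  rw [h2, Real.mul_rpow hμ.le (norm_nonneg _)]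
  gcongr
  have := hp.one_le x
  calc μ ^ p x ≤ max 1 μ ^ p x := by gcongr; exact le_max_right _ _
    _ ≤ max 1 μ ^ P := Real.rpow_le_rpow_of_exponent_le (le_max_left _ _) (hP x)

/-- The weak formulation holds for the products of the solution with test functions. -/
theorem integral_inner_test_mul_eq_zero (hp : IsExponent p) (hA : HasGrowth p A)
    (hu : Continuous u) (hG : MemSobolevLoc p u G)
    (hsol : ∀ φ : EuclideanSpace ℝ (Fin n) → ℝ, IsTest φ →
      ∫ x, inner ℝ (A x (u x) (G x)) (∇ φ x) = 0)
    {ψ : EuclideanSpace ℝ (Fin n) → ℝ} (hψ : IsTest ψ) :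
    Integrable (fun x => inner ℝ (A x (u x) (G x)) (ψ x • G x + u x • ∇ ψ x)) ∧
    ∫ x, inner ℝ (A x (u x) (G x)) (ψ x • G x + u x • ∇ ψ x) = 0 := by
  obtain ⟨P, hP⟩ := hp.exists_le
  obtain ⟨a, b, -, -, ⟨a₀, ha₀, haa⟩, hab, ⟨b₀, hbb⟩, -, hgr⟩ := hA.growth
  have hb₀ : 0 < b₀ := ha₀.trans_le ((haa 0).trans ((hab 0).trans (hbb 0)))
  set B := fun x => A x (u x) (G x) with hB
  have hBm : AEStronglyMeasurable B volume := by
    refine (aemeasurable_comp_of_continuous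
      (B := fun x (q : ℝ × EuclideanSpace ℝ (Fin n)) => A x q.1 q.2)
      (fun q => hA.caratheodory.measurable q.1 q.2) hA.caratheodory.continuous
      (g := fun x => (u x, G x)) ?_).aestronglyMeasurable
    exact hu.measurable.aemeasurable.prodMk
      hG.weakGradient.locInt_grad.aestronglyMeasurable.aemeasurable
  have hBle : ∀ x (v : EuclideanSpace ℝ (Fin n)),
      |inner ℝ (B x) v| ≤ b₀ * (‖G x‖ ^ p x + ‖v‖ ^ p x) := by
    intro x v
    have h1 : ‖B x‖ ≤ b₀ * ‖G x‖ ^ (p x - 1) :=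
      (hgr x (u x) (G x)).trans (mul_le_mul_of_nonneg_right (hbb x) (by positivity))
    calc |inner ℝ (B x) v| ≤ ‖B x‖ * ‖v‖ := abs_real_inner_le_norm _ _
      _ ≤ b₀ * ‖G x‖ ^ (p x - 1) * ‖v‖ := by gcongr
      _ = b₀ * (‖G x‖ ^ (p x - 1) * ‖v‖) := by ring
      _ ≤ _ := by
        gcongr
        exact rpow_sub_one_mul_le (norm_nonneg _) (norm_nonneg _) (hp.one_le x)
  have hvF := hG.weakGradient.test_mul hψ
  set v := fun x => ψ x * u x with hv
  set F := fun x => ψ x • G x + u x • ∇ ψ x with hF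
  set K := tsupport ψ with hK
  have hKc : IsCompact K := hψ.2
  have hF0 : ∀ x, x ∉ K → F x = 0 := by
    intro x hx
    have h1 : ψ x = 0 := image_eq_zero_of_notMem_tsupport hx
    have h2 : ∇ ψ x = 0 := by
      simp only [gradient]
      rw [fderiv_of_notMem_tsupport ℝ hx, map_zero]
    simp [hF, h1, h2]
  obtain ⟨C₁, hC₁⟩ := hψ.1.continuous.bounded_above_of_compact_support hψ.2
  obtain ⟨C₂, hC₂⟩ := (hu.smul hψ.continuous_gradient).bounded_above_of_compact_support
    hψ.hasCompactSupport_gradient.smul_left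
  set C := max 1 (max C₁ C₂) with hC
  have hC1 : 1 ≤ C := le_max_left _ _
  have hFle : ∀ x, ‖F x‖ ≤ C * (‖G x‖ + 1) := by
    intro x
    have h1 : ‖ψ x‖ ≤ C := (hC₁ x).trans ((le_max_left _ _).trans (le_max_right _ _))
    have h2 : ‖u x • ∇ ψ x‖ ≤ C := (hC₂ x).trans ((le_max_right _ _).trans (le_max_right _ _))
    calc ‖F x‖ ≤ ‖ψ x • G x‖ + ‖u x • ∇ ψ x‖ := norm_add_le _ _
      _ = ‖ψ x‖ * ‖G x‖ + ‖u x • ∇ ψ x‖ := by rw [norm_smul (ψ x)]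
      _ ≤ C * ‖G x‖ + C := by gcongr
      _ = _ := by ring
  have hGp : ∀ K : Set (EuclideanSpace ℝ (Fin n)), IsCompact K →
      IntegrableOn (fun x => ‖G x‖ ^ p x) K := fun K hK =>
    hp.integrableOn_norm_rpow (hG.memLp_grad K hK)
  have hFp : Integrable fun x => ‖F x‖ ^ p x := by
    have h1 : IntegrableOn (fun x => ‖F x‖ ^ p x) K := by
      have h2 : IntegrableOn (fun x => (2 * C) ^ P * (‖G x‖ ^ p x + 1)) K :=
        ((hGp K hKc).add (integrableOn_const hKc.measure_lt_top.ne)).const_mul _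
      refine Integrable.mono' h2 (hp.aestronglyMeasurable_norm_rpow
        hvF.locInt_grad.aestronglyMeasurable.restrict) (ae_of_all _ fun x => ?_)
      rw [Real.norm_of_nonneg (by positivity)]
      have hpx : 0 ≤ p x := by linarith [hp.one_le x]
      exact (Real.rpow_le_rpow (norm_nonneg _) (hFle x) hpx).trans
        (mul_add_one_rpow_le hC1 (norm_nonneg _) hpx (hP x))
    refine (integrableOn_iff_integrable_of_support_subset fun x hx => ?_).1 h1
    by_contra hxK
    have hpx : p x ≠ 0 := by linarith [hp.one_le x]
    exact hx (by simp [hF0 x hxK, Real.zero_rpow hpx])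
  obtain ⟨C₃, hC₃, hρle⟩ := exists_bump_le n
  obtain ⟨D, hD, hmoll⟩ := hp.norm_integral_rpow_le (F := EuclideanSpace ℝ (Fin n)) hC₃
    (integral_nonneg (fun x => by positivity) : 0 ≤ ∫ x, ‖F x‖ ^ p x)
  set ρ := fun k => (bump n k).normed volume with hρ
  set Fk := fun k => (ρ k ⋆[ContinuousLinearMap.lsmul ℝ ℝ, volume] F) with hFk
  set h := fun x => ‖F x‖ ^ p x with hh
  set hk := fun k => (ρ k ⋆[ContinuousLinearMap.lsmul ℝ ℝ, volume] h) with hhk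
  -- The mollifiers have radius at most `1`, so every `Fk k` vanishes off this one compact set.
  set K₁ := Metric.cthickening 1 K with hK₁
  have hK₁c : IsCompact K₁ := hKc.cthickening
  have hρx : ∀ k x y, ρ k (x - y) ≠ 0 → ‖x - y‖ ≤ (bump n k).rOut := by
    intro k x y hne
    have : x - y ∈ Function.support (ρ k) := hne
    rw [hρ, (bump n k).support_normed_eq] at this
    simpa using (Metric.mem_ball.1 this).le
  have hFk0 : ∀ k x, x ∉ K₁ → Fk k x = 0 := by
    intro k x hx
    simp only [hFk]
    rw [convolution_eq_swap]
    refine integral_eq_zero_of_ae (ae_of_all _ fun y => ?_)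
    by_cases hy : y ∈ K
    · by_cases hne : ρ k (x - y) = 0
      · simp [hne]
      · refine absurd (Metric.mem_cthickening_of_dist_le x y 1 K hy ?_) hx
        rw [dist_eq_norm]
        exact (hρx k x y hne).trans (bump_rOut_le_one n k)
    · simp [hF0 y hy]
  have hFkp : ∀ k x, ‖Fk k x‖ ^ p x ≤ D * (hk k x + 1) := by
    intro k x
    have := hmoll (bump n k).rOut (bump n k).rOut_pos (bump_rOut_le_one n k)
      (fun y => ρ k (x - y)) F x (fun y => (bump n k).nonneg_normed _)
      ((bump n k).integrable_normed.comp_sub_left x)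
      ((integral_sub_left_eq_self _ volume x).trans (bump n k).integral_normed)
      (fun y => hρle k _) (fun y => hρx k x y)
      (hvF.locInt_grad.integrable_smul_left_of_hasCompactSupport
        ((isTest_bump n k).comp_sub_left x).1.continuous ((isTest_bump n k).comp_sub_left x).2)
      hFp le_rfl
    simp only [hFk, hhk]
    rw [convolution_eq_swap, convolution_eq_swap]
    exact this
  have hkint : ∀ k, Integrable (hk k) := fun k =>
    (bump n k).integrable_normed.integrable_convolution _ hFp
  -- The summand `D` comes from the `+ 1` in the modular estimate; it is integrable because it is
  -- needed only on `K₁`.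
  have hG₁ : Integrable (K₁.indicator fun x => ‖G x‖ ^ p x + D) :=
    (integrable_indicator_iff hK₁c.measurableSet).2
      ((hGp K₁ hK₁c).add (integrableOn_const hK₁c.measure_lt_top.ne))
  have hk0 : ∀ k x, 0 ≤ hk k x := by
    intro k x
    simp only [hhk]
    rw [convolution_eq_swap]
    exact integral_nonneg fun y => mul_nonneg ((bump n k).nonneg_normed _) (by positivity)
  have hbound : ∀ k x, |inner ℝ (B x) (Fk k x)| ≤
      b₀ * (K₁.indicator (fun x => ‖G x‖ ^ p x + D) x + D * hk k x) := by
    intro k x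
    have := hk0 k x
    by_cases hx : x ∈ K₁
    · rw [Set.indicator_of_mem hx]
      refine (hBle x _).trans ?_
      refine mul_le_mul_of_nonneg_left ?_ hb₀.le
      linarith [hFkp k x]
    · rw [hFk0 k x hx, Set.indicator_of_notMem hx]
      simp only [inner_zero_right, abs_zero]
      positivity
  have hFklim : ∀ᵐ x, Tendsto (fun k => Fk k x) atTop (𝓝 (F x)) :=
    ContDiffBump.ae_convolution_tendsto_right_of_locallyIntegrable (tendsto_bump_rOut n)
      (Eventually.of_forall (bump_rOut_le n)) hvF.locInt_grad
  have hklim : ∀ᵐ x, Tendsto (fun k => hk k x) atTop (𝓝 (h x)) :=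
    ContDiffBump.ae_convolution_tendsto_right_of_locallyIntegrable (tendsto_bump_rOut n)
      (Eventually.of_forall (bump_rOut_le n)) hFp.locallyIntegrable
  -- Mollification preserves the integral, so the majorants converge in integral as well as almost
  -- everywhere.
  have hkI : ∀ k, ∫ x, hk k x = ∫ x, h x := by
    intro k
    refine (integral_convolution _ (bump n k).integrable_normed hFp).trans ?_
    rw [(bump n k).integral_normed]
    simp
  have hlimit := tendsto_integral_of_tendsto_bound (μ := volume)
    (f := fun k x => inner ℝ (B x) (Fk k x)) (f₀ := fun x => inner ℝ (B x) (F x))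
    (g := fun k x => b₀ * (K₁.indicator (fun x => ‖G x‖ ^ p x + D) x + D * hk k x))
    (g₀ := fun x => b₀ * (K₁.indicator (fun x => ‖G x‖ ^ p x + D) x + D * h x))
    (fun k => hBm.inner ((isTest_bump n k).2.continuous_convolution_left _
      (isTest_bump n k).1.continuous hvF.locInt_grad).aestronglyMeasurable)
    (fun k => (hG₁.add ((hkint k).const_mul D)).const_mul b₀)
    ((hG₁.add (hFp.const_mul D)).const_mul b₀)
    (fun k => ae_of_all _ (hbound k))
    (by
      filter_upwards [hFklim] with x hx
      exact tendsto_const_nhds.inner hx)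
    (by
      filter_upwards [hklim] with x hx
      exact ((hx.const_mul D).const_add _).const_mul b₀)
    (by
      refine tendsto_const_nhds.congr fun k => ?_
      rw [integral_const_mul, integral_const_mul, integral_add hG₁ ((hkint k).const_mul D),
        integral_add hG₁ (hFp.const_mul D), integral_const_mul, integral_const_mul, hkI])
  refine ⟨?_, ?_⟩
  · refine ((hGp K hKc).integrable_indicator hKc.measurableSet |>.add hFp |>.const_mul b₀).mono'
      (hBm.inner hvF.locInt_grad.aestronglyMeasurable) (ae_of_all _ fun x => ?_)
    by_cases hx : x ∈ K
    · simp only [Pi.add_apply, Set.indicator_of_mem hx]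
      exact hBle x (F x)
    · change ‖inner ℝ (B x) (F x)‖ ≤ b₀ * (K.indicator (fun x => ‖G x‖ ^ p x) x + ‖F x‖ ^ p x)
      rw [Set.indicator_of_notMem hx, hF0 x hx]
      simp only [inner_zero_right, norm_zero, zero_add]
      positivity
  · refine tendsto_nhds_unique hlimit (tendsto_const_nhds.congr fun k => ?_)
    have hvc : HasCompactSupport v := hψ.2.mul_right
    rw [← hsol _ (isTest_convolution (isTest_bump n k) hvF.locInt hvc)]
    congr 1
    ext x
    rw [hvF.gradient_convolution (isTest_bump n k)]

end WeakFormulation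

/-! ### Caccioppoli inequality and vanishing of the gradient -/

section Caccioppoli

variable {n : ℕ} {p u : EuclideanSpace ℝ (Fin n) → ℝ}
  {G : EuclideanSpace ℝ (Fin n) → EuclideanSpace ℝ (Fin n)}
  {A : EuclideanSpace ℝ (Fin n) → ℝ → EuclideanSpace ℝ (Fin n) → EuclideanSpace ℝ (Fin n)}

theorem IsTest.pow {η : EuclideanSpace ℝ (Fin n) → ℝ} (hη : IsTest η) {m : ℕ} (hm : m ≠ 0) :
    IsTest fun x => η x ^ m :=
  ⟨hη.1.pow m, hη.2.comp_left (g := fun t : ℝ => t ^ m) (zero_pow hm)⟩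

theorem gradient_pow {η : EuclideanSpace ℝ (Fin n) → ℝ} {x : EuclideanSpace ℝ (Fin n)}
    (hη : DifferentiableAt ℝ η x) (m : ℕ) :
    ∇ (fun y => η y ^ m) x = (m * η x ^ (m - 1)) • ∇ η x := by
  refine (InnerProductSpace.toDual ℝ _).injective ?_
  rw [toDual_gradient, map_smul, toDual_gradient, (hη.hasFDerivAt.pow m).fderiv]
  simp

/-- The Caccioppoli inequality. -/
theorem exists_caccioppoli (hp : IsExponent p) (hA : HasGrowth p A)
    (hu : Continuous u) (hG : MemSobolevLoc p u G)
    (hsol : ∀ φ : EuclideanSpace ℝ (Fin n) → ℝ, IsTest φ →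
      ∫ x, inner ℝ (A x (u x) (G x)) (∇ φ x) = 0) :
    ∃ Γ : ℝ, 0 ≤ Γ ∧ ∃ m : ℕ, ∀ η : EuclideanSpace ℝ (Fin n) → ℝ, IsTest η →
      (∀ x, 0 ≤ η x) → (∀ x, η x ≤ 1) →
      Integrable (fun x => η x ^ m * ‖G x‖ ^ p x) ∧
      ∫ x, η x ^ m * ‖G x‖ ^ p x ≤ ∫ x, (Γ * (|u x| * ‖∇ η x‖)) ^ p x := by
  obtain ⟨P, hP⟩ := hp.exists_le
  obtain ⟨m, hm⟩ := exists_nat_ge P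
  have hm0 : m ≠ 0 := by
    rintro rfl
    have := hp.one_le 0
    have := hP 0
    norm_num at hm
    linarith
  obtain ⟨a, b, -, -, ⟨a₀, ha₀, haa⟩, hab, ⟨b₀, hbb⟩, hel, hgr⟩ := hA.growth
  have hb₀ : 0 < b₀ := ha₀.trans_le ((haa 0).trans ((hab 0).trans (hbb 0)))
  -- Young's inequality then costs half of the elliptic term, and the other half remains on the
  -- left. In the constant below, `b₀` comes from the growth of `A`, `m` from differentiating `η ^
  -- m`, and `1 / δ` from Young.
  set δ := a₀ / 2 with hδ
  have hδ0 : 0 < δ := by positivity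
  refine ⟨b₀ * m / δ, by positivity, m, fun η hη hη0 hη1 => ?_⟩
  obtain ⟨hint, hzero⟩ := integral_inner_test_mul_eq_zero hp hA hu hG hsol (hη.pow hm0)
  have hηm := hη.pow hm0
  have hGm : AEStronglyMeasurable (fun x => ‖G x‖ ^ p x) volume :=
    hp.aestronglyMeasurable_norm_rpow hG.weakGradient.locInt_grad.aestronglyMeasurable
  set S := fun x => (b₀ * m / δ * (|u x| * ‖∇ η x‖)) ^ p x with hS
  have hpt : ∀ x, δ * (η x ^ m * ‖G x‖ ^ p x) ≤
      inner ℝ (A x (u x) (G x)) (η x ^ m • G x + u x • ∇ (fun y => η y ^ m) x) + δ * S x := by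
    intro x
    have h1 : a₀ * ‖G x‖ ^ p x ≤ inner ℝ (A x (u x) (G x)) (G x) :=
      (mul_le_mul_of_nonneg_right (haa x) (by positivity)).trans (hel x (u x) (G x))
    have h2 : ‖A x (u x) (G x)‖ ≤ b₀ * ‖G x‖ ^ (p x - 1) :=
      (hgr x (u x) (G x)).trans (mul_le_mul_of_nonneg_right (hbb x) (by positivity))
    have h3 := young_weighted (hη0 x) (hη1 x) (norm_nonneg (G x))
      (by positivity : 0 ≤ b₀ * m * (|u x| * ‖∇ η x‖)) (hp.one_le x) ((hP x).trans hm) hδ0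
    have h4 : b₀ * m * (|u x| * ‖∇ η x‖) / δ = b₀ * m / δ * (|u x| * ‖∇ η x‖) := by ring
    rw [h4] at h3
    have h5 : |inner ℝ (A x (u x) (G x)) (∇ η x)| ≤ b₀ * ‖G x‖ ^ (p x - 1) * ‖∇ η x‖ :=
      (abs_real_inner_le_norm _ _).trans (by gcongr)
    have hη0x := hη0 x
    rw [gradient_pow hη.differentiable.differentiableAt, inner_add_right, inner_smul_right,
      inner_smul_right, inner_smul_right]
    have h6 : |u x * (m * η x ^ (m - 1) * inner ℝ (A x (u x) (G x)) (∇ η x))| ≤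
        η x ^ (m - 1) * ‖G x‖ ^ (p x - 1) * (b₀ * m * (|u x| * ‖∇ η x‖)) := by
      rw [abs_mul, abs_mul, abs_of_nonneg (by positivity : 0 ≤ (m : ℝ) * η x ^ (m - 1))]
      calc |u x| * (m * η x ^ (m - 1) * |inner ℝ (A x (u x) (G x)) (∇ η x)|)
          ≤ |u x| * (m * η x ^ (m - 1) * (b₀ * ‖G x‖ ^ (p x - 1) * ‖∇ η x‖)) := by gcongr
        _ = _ := by ring
    have h7 := (abs_le.1 (h6.trans h3)).1
    have h8 : η x ^ m * (a₀ * ‖G x‖ ^ p x) ≤ η x ^ m * inner ℝ (A x (u x) (G x)) (G x) := by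
      gcongr
    have h9 : a₀ = 2 * δ := by rw [hδ]; ring
    rw [h9] at h8
    simp only [hS]
    linarith
  have hSc : Continuous S := by
    refine Continuous.rpow (continuous_const.mul (hu.abs.mul hη.continuous_gradient.norm))
      hp.continuous fun x => Or.inr ?_
    linarith [hp.one_le x]
  have hSs : HasCompactSupport S := by
    refine hη.hasCompactSupport_gradient.mono fun x hx => ?_
    by_contra h0
    have h0 : ∇ η x = 0 := by simpa using h0
    have hpx : p x ≠ 0 := by linarith [hp.one_le x]
    exact hx (by simp [hS, h0, Real.zero_rpow hpx])
  have hSi : Integrable S := hSc.integrable_of_hasCompactSupport hSs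
  have hLi : Integrable fun x => η x ^ m * ‖G x‖ ^ p x := by
    refine ((hint.add (hSi.const_mul δ)).const_mul δ⁻¹).mono'
      (hηm.1.continuous.aestronglyMeasurable.mul hGm) (ae_of_all _ fun x => ?_)
    have hη0x := hη0 x
    rw [Real.norm_of_nonneg (by positivity), le_inv_mul_iff₀ hδ0]
    exact hpt x
  refine ⟨hLi, ?_⟩
  have := integral_mono (hLi.const_mul δ) (hint.add (hSi.const_mul δ)) hpt
  rw [integral_add' hint (hSi.const_mul δ), hzero, zero_add, integral_const_mul,
    integral_const_mul] at this
  exact le_of_mul_le_mul_left this hδ0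

/-- Scaled cutoff functions with gradient of order `1 / R` in the annulus. -/
theorem exists_cutoff (n : ℕ) : ∃ C : ℝ, 0 ≤ C ∧
    ∀ (x₀ : EuclideanSpace ℝ (Fin n)) (R : ℝ), 0 < R →
    ∃ η : EuclideanSpace ℝ (Fin n) → ℝ, IsTest η ∧ (∀ x, 0 ≤ η x) ∧ (∀ x, η x ≤ 1) ∧
      (∀ x ∈ Metric.ball x₀ R, η x = 1) ∧ (∀ x, ‖∇ η x‖ ≤ C / R) ∧
      ∀ x, x ∉ Metric.ball x₀ (2 * R) \ Metric.ball x₀ R → ∇ η x = 0 := by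
  let f : ContDiffBump (0 : EuclideanSpace ℝ (Fin n)) := ⟨1, 2, by norm_num, by norm_num⟩
  have hf : IsTest f := ⟨f.contDiff, f.hasCompactSupport⟩
  obtain ⟨C, hC⟩ := hf.continuous_gradient.bounded_above_of_compact_support
    hf.hasCompactSupport_gradient
  refine ⟨C, (norm_nonneg _).trans (hC 0), fun x₀ R hR => ?_⟩
  have hlt : ∀ {x : EuclideanSpace ℝ (Fin n)} {t : ℝ},
      ‖R⁻¹ • (x - x₀)‖ < t ↔ x ∈ Metric.ball x₀ (t * R) := by
    intro x t
    rw [norm_smul, norm_inv, Real.norm_of_nonneg hR.le, Metric.mem_ball, dist_eq_norm,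
      inv_mul_lt_iff₀ hR, mul_comm]
  have h1 : ∀ x ∈ Metric.ball x₀ R, f (R⁻¹ • (x - x₀)) = 1 := by
    intro x hx
    apply f.one_of_mem_closedBall
    have : ‖R⁻¹ • (x - x₀)‖ < 1 := hlt.2 (by simpa using hx)
    simpa using this.le
  have h0 : ∀ x, x ∉ Metric.ball x₀ (2 * R) → f (R⁻¹ • (x - x₀)) = 0 := by
    intro x hx
    apply f.zero_of_le_dist
    have : ¬ ‖R⁻¹ • (x - x₀)‖ < 2 := fun h => hx (hlt.1 h)
    simpa using this
  have hgrad : ∀ x, ∇ (fun y => f (R⁻¹ • (y - x₀))) x = R⁻¹ • ∇ f (R⁻¹ • (x - x₀)) := by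
    intro x
    have h := ((hf.differentiable (R⁻¹ • (x - x₀))).hasFDerivAt.comp x
      (((hasFDerivAt_id x).sub_const x₀).const_smul R⁻¹)).fderiv
    refine (InnerProductSpace.toDual ℝ _).injective ?_
    rw [toDual_gradient, map_smul, toDual_gradient]
    refine h.trans ?_
    ext v
    simp
  refine ⟨fun x => f (R⁻¹ • (x - x₀)), ⟨f.contDiff.comp (by fun_prop), ?_⟩, fun x => f.nonneg,
    fun x => f.le_one, h1, fun x => ?_, fun x hx => ?_⟩
  · refine HasCompactSupport.of_support_subset_isCompact (isCompact_closedBall x₀ (2 * R)) ?_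
    intro x hx
    by_contra h
    exact hx (h0 x fun h' => h (Metric.ball_subset_closedBall h'))
  · rw [hgrad, norm_smul, norm_inv, Real.norm_of_nonneg hR.le, div_eq_inv_mul]
    gcongr
    exact hC _
  · have hz : fderiv ℝ (fun y => f (R⁻¹ • (y - x₀))) x = 0 := by
      by_cases hx1 : x ∈ Metric.ball x₀ R
      · refine IsLocalMax.fderiv_eq_zero (Eventually.of_forall fun y => ?_)
        dsimp only
        rw [h1 x hx1]
        exact f.le_one
      · refine IsLocalMin.fderiv_eq_zero (Eventually.of_forall fun y => ?_)
        dsimp only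
        rw [h0 x fun h => hx ⟨h, hx1⟩]
        exact f.nonneg
    rw [gradient, hz, map_zero]

/-- Decay of `u` on annuli forces the gradient to vanish. -/
theorem ae_gradient_eq_zero (hp : IsExponent p) (hA : HasGrowth p A)
    (hu : Continuous u) (hG : MemSobolevLoc p u G)
    (hsol : ∀ φ : EuclideanSpace ℝ (Fin n) → ℝ, IsTest φ →
      ∫ x, inner ℝ (A x (u x) (G x)) (∇ φ x) = 0)
    {α : ℝ} (hα : n / pMinus p - 1 < α) {x₀ : EuclideanSpace ℝ (Fin n)} {c : ℝ} {R : ℕ → ℝ}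
    (hRpos : ∀ k, 0 < R k) (hRtop : Tendsto R atTop atTop)
    (hdecay : ∀ k, ∀ x ∈ Metric.ball x₀ (2 * R k) \ Metric.ball x₀ (R k),
      |u x| ≤ c / R k ^ α) :
    ∀ᵐ x, G x = 0 := by
  obtain ⟨Γ, hΓ, m, hcac⟩ := exists_caccioppoli hp hA hu hG hsol
  obtain ⟨C, hC, hcut⟩ := exists_cutoff n
  set q := pMinus p with hq
  have hq1 : 1 < q := hp.one_lt_pMinus
  have hq0 : 0 < q := by linarith
  have hexp : 0 < (α + 1) * q - n := by
    have h : n / q < α + 1 := by linarith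
    rw [div_lt_iff₀ hq0] at h
    linarith
  have hα1 : 0 < α + 1 := by
    have : 0 ≤ n / q := by positivity
    linarith
  set T := Γ * (|c| * C) with hT
  have hT0 : 0 ≤ T := by positivity
  set V := volume.real (Metric.ball (0 : EuclideanSpace ℝ (Fin n)) 1) with hV
  -- The smallness condition is what allows the exponent `p x` to be lowered to `q`; it holds for
  -- all large `k` because `α + 1 > 0`.
  have henergy : ∀ k, T * R k ^ (-(α + 1)) ≤ 1 →
      IntegrableOn (fun x => ‖G x‖ ^ p x) (Metric.ball x₀ (R k)) ∧
      ∫ x in Metric.ball x₀ (R k), ‖G x‖ ^ p x ≤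
        2 ^ n * V * T ^ q * R k ^ (-((α + 1) * q - n)) := by
    intro k hk
    have hR := hRpos k
    obtain ⟨η, hη, hη0, hη1, hηb, hηg, hηz⟩ := hcut x₀ (R k) hR
    obtain ⟨hi, hle⟩ := hcac η hη hη0 hη1
    have heq : Set.EqOn (fun x => η x ^ m * ‖G x‖ ^ p x) (fun x => ‖G x‖ ^ p x)
        (Metric.ball x₀ (R k)) := fun x hx => by simp [hηb x hx]
    refine ⟨hi.integrableOn.congr_fun heq measurableSet_ball, ?_⟩
    rw [← setIntegral_congr_fun measurableSet_ball heq]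
    refine (setIntegral_le_integral hi (ae_of_all _ fun x => ?_)).trans (hle.trans ?_)
    · have := hη0 x
      simp only [Pi.zero_apply]
      positivity
    set τ := T * R k ^ (-(α + 1)) with hτ
    have hτ0 : 0 ≤ τ := by positivity
    have hpt : ∀ x, (Γ * (|u x| * ‖∇ η x‖)) ^ p x ≤
        (Metric.ball x₀ (2 * R k)).indicator (fun _ => τ ^ q) x := by
      intro x
      have hpx := hp.one_le x
      by_cases hx : x ∈ Metric.ball x₀ (2 * R k) \ Metric.ball x₀ (R k)
      · rw [Set.indicator_of_mem hx.1]
        have h1 : Γ * (|u x| * ‖∇ η x‖) ≤ τ := by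
          have h2 : |u x| ≤ |c| / R k ^ α := (hdecay k x hx).trans (by gcongr; exact le_abs_self c)
          have h3 := hηg x
          calc Γ * (|u x| * ‖∇ η x‖) ≤ Γ * (|c| / R k ^ α * (C / R k)) := by gcongr
            _ = τ := by
              rw [hτ, hT, Real.rpow_neg hR.le, Real.rpow_add_one hR.ne']
              have : R k ^ α ≠ 0 := by positivity
              field_simp
        calc (Γ * (|u x| * ‖∇ η x‖)) ^ p x ≤ τ ^ p x := by gcongr
          _ ≤ τ ^ q := Real.rpow_le_rpow_of_exponent_ge' hτ0 hk hq0.le (hp.pMinus_le x)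
      · rw [hηz x hx]
        have : p x ≠ 0 := by linarith
        simp only [norm_zero, mul_zero, Real.zero_rpow this]
        exact Set.indicator_nonneg (fun _ _ => by positivity) x
    have hbi : Integrable ((Metric.ball x₀ (2 * R k)).indicator fun _ => τ ^ q) :=
      (integrable_indicator_iff measurableSet_ball).2 (integrableOn_const measure_ball_lt_top.ne)
    refine (integral_mono_of_nonneg (ae_of_all _ fun x => ?_) hbi (ae_of_all _ hpt)).trans ?_
    · simp only [Pi.zero_apply]
      positivity
    rw [integral_indicator measurableSet_ball, setIntegral_const, measureReal_def,
      Measure.addHaar_ball_of_pos _ _ (by positivity), ENNReal.toReal_mul,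
      ENNReal.toReal_ofReal (by positivity), ← measureReal_def, ← hV, smul_eq_mul, hτ,
      Real.mul_rpow hT0 (by positivity), ← Real.rpow_mul hR.le]
    simp only [finrank_euclideanSpace, Fintype.card_fin]
    have h5 : R k ^ (-((α + 1) * q - n)) = R k ^ (-(α + 1) * q) * R k ^ n := by
      rw [← Real.rpow_natCast, ← Real.rpow_add hR]
      congr 1
      ring
    rw [h5, mul_pow]
    apply le_of_eq
    ring
  have hlim1 : Tendsto (fun k => T * R k ^ (-(α + 1))) atTop (𝓝 0) := by
    simpa using ((tendsto_rpow_neg_atTop hα1).comp hRtop).const_mul T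
  have hlim2 : Tendsto (fun k => 2 ^ n * V * T ^ q * R k ^ (-((α + 1) * q - n))) atTop (𝓝 0) := by
    simpa using ((tendsto_rpow_neg_atTop hexp).comp hRtop).const_mul (2 ^ n * V * T ^ q)
  have hsmall : ∀ᶠ k in atTop, T * R k ^ (-(α + 1)) ≤ 1 :=
    (hlim1.eventually_lt_const one_pos).mono fun k hk => hk.le
  -- A fixed ball lies in all balls of large radius `R k`, so its energy is below a sequence tending
  -- to zero.
  have hball : ∀ j : ℕ, ∀ᵐ x ∂volume.restrict (Metric.ball x₀ j), G x = 0 := by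
    intro j
    have hge : ∀ᶠ k in atTop, T * R k ^ (-(α + 1)) ≤ 1 ∧ (j : ℝ) ≤ R k :=
      hsmall.and (hRtop.eventually_ge_atTop _)
    have hint : IntegrableOn (fun x => ‖G x‖ ^ p x) (Metric.ball x₀ j) := by
      obtain ⟨k, hk1, hk2⟩ := hge.exists
      exact (henergy k hk1).1.mono_set (Metric.ball_subset_ball hk2)
    have hzero : ∫ x in Metric.ball x₀ j, ‖G x‖ ^ p x ≤ 0 := by
      refine ge_of_tendsto hlim2 (hge.mono fun k hk => ?_)
      refine le_trans ?_ (henergy k hk.1).2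
      exact setIntegral_mono_set (henergy k hk.1).1 (ae_of_all _ fun x => by positivity)
        (Metric.ball_subset_ball hk.2).eventuallyLE
    have hnn : 0 ≤ fun x => ‖G x‖ ^ p x := fun x => by
      simp only [Pi.zero_apply]
      positivity
    have := (integral_eq_zero_iff_of_nonneg hnn hint).1
      (le_antisymm hzero (integral_nonneg hnn))
    filter_upwards [this] with x hx
    have hpx : p x ≠ 0 := by linarith [hp.one_le x]
    simpa using (Real.rpow_eq_zero (norm_nonneg _) hpx).1 hx
  have := ae_restrict_iUnion_iff (fun j : ℕ => Metric.ball x₀ (j : ℝ)) (fun x => G x = 0)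
    (μ := volume) |>.2 hball
  rwa [Metric.iUnion_ball_nat, Measure.restrict_univ] at this

end Caccioppoli

end VariableExponent

theorem theorem3p6 (n : ℕ) (hn : 2 ≤ n)
    (p : EuclideanSpace ℝ (Fin n) → ℝ) (hp : VariableExponent.IsExponent p)
    (hpn : VariableExponent.pMinus p < n)
    (A : EuclideanSpace ℝ (Fin n) → ℝ → EuclideanSpace ℝ (Fin n) → EuclideanSpace ℝ (Fin n))
    (hA : VariableExponent.HasGrowth p A)
    (u : EuclideanSpace ℝ (Fin n) → ℝ) (hu : VariableExponent.IsHarmonic p A u)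
    (hbdd : ∃ M : ℝ, ∀ x, |u x| ≤ M)
    (α : ℝ) (hα : n / VariableExponent.pMinus p - 1 < α)
    (x₀ : EuclideanSpace ℝ (Fin n))
    (c : ℝ) (R : ℕ → ℝ) (hRpos : ∀ k, 0 < R k) (hRmono : Monotone R)
    (hRtop : Filter.Tendsto R Filter.atTop Filter.atTop)
    (hdecay : ∀ k, ∀ x ∈ Metric.ball x₀ (2 * R k) \ Metric.ball x₀ (R k), |u x| ≤ c / R k ^ α) :
    ∃ C : ℝ, ∀ x, u x = C := by
  obtain ⟨G, hG, hsol⟩ := hu.weakSolution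
  exact ⟨u x₀, fun x => hG.weakGradient.eq_of_ae_zero hu.continuous
    (VariableExponent.ae_gradient_eq_zero hp hA hu.continuous hG hsol hα hRpos hRtop hdecay) x x₀⟩
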